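/- Let $(\Omega,\mathcal F,\mathbb P)$ be a probability space, let $\mathbb D$ be either $\mathbb R$ or $(0,\infty)$, let $R:\mathbb D\to\mathbb R$ be strictly increasing, differentiable and concave, and let $\mathcal X\in L^\infty$ satisfy $\operatorname{ess\,inf}\mathcal X\in\mathbb D$. If $\mathbb D=(0,\infty)$, put $\exp(-R(0)):=\lim_{x\searrow 0}\exp(-R(x))\in(0,\infty]$. For $Z\in L^\infty$ and $v\in\mathbb R$ such that $\mathcal X+Z-v$ lies a.s. in the closure of $\mathbb D$ and $\mathbb E[\exp(-R(\mathcal X+Z-v))]<\infty$ (we then say that $H_Z(v)$ is well defined), let $$H_Z(v):=\frac{\mathbb E[Z\exp(-R(\mathcal X+Z-v))]}{\mathbb E[\exp(-R(\mathcal X+Z-v))]}.$$ Let $V(Z)$ be the set of all $v$ such that $H_Z(v)$ is well defined and $H_Z(v)=v$, and define $\bar V:L^\infty\to\mathbb R$ by $$\bar V(Z):=\begin{cases}\min V(Z)&\text{if }V(Z)\neq\emptyset,\\ \operatorname{ess\,inf}[\mathcal X+Z]&\text{if }V(Z)=\emptyset.\end{cases}$$ Then the minimum exists whenever $V(Z)\ne\emptyset$,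 and the following hold. 1. $\bar V(Z)\in[\operatorname{ess\,inf}Z,\operatorname{ess\,sup}Z]$ for every $Z\in L^\infty$. 2. $\bar V(Z_1)=\bar V(Z_2)$ for all $Z_1,Z_2\in L^\infty$ such that $(Z_1,\mathcal X+Z_1)$ and $(Z_2,\mathcal X+Z_2)$ are equal in distribution. 3. $\bar V(Z+z)=\bar V(Z)+z$ for every $Z\in L^\infty$ and $z\in\mathbb R$. 4. $\bar V$ is lower semicontinuous in the norm topology of $L^\infty$. Moreover, $\bar V$ is norm continuous at every $Z\in L^\infty$ such that $Z$ and $\mathcal X+Z$ are comonotonic, that is, $(Z(\omega)-Z(\omega'))\,((\mathcal X+Z)(\omega)-(\mathcal X+Z)(\omega'))\ge 0$ for $\mathbb P\otimes\mathbb P$-almost all $(\omega,\omega')$; and $\bar V$ is norm continuous on all of $L^\infty$ if $R$ is linear (of the form $x\mapsto ax+b$ on $\mathbb D$), or if $z\in[0,\infty)\mapsto z\exp(-R(\mathcal X+z))$ is a.s. nondecreasing, or if this map is a.s. concave. 5. If $z\in[0,\infty)\mapsto z\exp(-R(\mathcal X+z))$ is a.s. nondecreasing, then $\bar V(Z_1)\ge\bar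 V(Z_2)$ for all $Z_1,Z_2\in L^\infty$ with $Z_1\ge Z_2$ a.s., and $\bar V$ is Lipschitz continuous with constant $1$ with respect to $\|\cdot\|_\infty$. 6. If $z\in[0,\infty)\mapsto z\exp(-R(\mathcal X+z))$ is a.s. concave, then $\bar V$ is concave, and it is upper semicontinuous in the weak* topology, the coarsest topology on $L^\infty$ for which $Y\mapsto\mathbb E[Y^*Y]$ is continuous for every $Y^*\in L^1$. -/

import Mathlib

open MeasureTheory ProbabilityTheory Set Filter Topology
open scoped ENNReal

noncomputable section

namespace EqPricing

variable {Ω : Type*} [MeasurableSpace Ω]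

/-- The weight `exp (-R x)`, with values in `[0, ∞]`. At a boundary point of `D` (that is, at `0`
when `D = (0, ∞)`) it is the limit of `exp (-R y)` as `y → x` in `D`, which may be `∞`; as `R` is
increasing, this limit is the supremum of `exp (-R y)` over `y ∈ D`. -/
def weight (D : Set ℝ) (R : ℝ → ℝ) (x : ℝ) : ℝ≥0∞ :=
  open scoped Classical in
  if x ∈ D then ENNReal.ofReal (Real.exp (-R x))
  else ⨆ y ∈ D, ENNReal.ofReal (Real.exp (-R y))

/-- `H_Z(v)` is well defined: `𝒳 + Z - v` lies a.s. in the closure of the domain `D` of `R`, and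
`E[exp (-R (𝒳 + Z - v))] < ∞`. -/
def Feasible (P : Measure Ω) (D : Set ℝ) (R : ℝ → ℝ) (X Z : Lp ℝ ∞ P) (v : ℝ) : Prop :=
  (∀ᵐ ω ∂P, X ω + Z ω - v ∈ closure D) ∧ ∫⁻ ω, weight D R (X ω + Z ω - v) ∂P < ∞

/-- `H_Z(v) = E[Z exp (-R (𝒳 + Z - v))] / E[exp (-R (𝒳 + Z - v))]`, meaningful for feasible `v`. -/
def H (P : Measure Ω) (D : Set ℝ) (R : ℝ → ℝ) (X Z : Lp ℝ ∞ P) (v : ℝ) : ℝ :=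
  (∫ ω, Z ω * (weight D R (X ω + Z ω - v)).toReal ∂P) /
    ∫ ω, (weight D R (X ω + Z ω - v)).toReal ∂P

/-- The set `V(Z)` of all prices of `Z`, i.e. of the fixed points of `H_Z`. -/
def V (P : Measure Ω) (D : Set ℝ) (R : ℝ → ℝ) (X Z : Lp ℝ ∞ P) : Set ℝ :=
  {v | Feasible P D R X Z v ∧ H P D R X Z v = v}

/-- The extension and selection `V̄`: the smallest price of `Z` if there is one, and
`ess inf [𝒳 + Z]` otherwise. -/
def Vbar (P : Measure Ω) (D : Set ℝ) (R : ℝ → ℝ) (X : Lp ℝ ∞ P) (Z : Lp ℝ ∞ P) : ℝ :=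
  open scoped Classical in
  if (V P D R X Z).Nonempty then sInf (V P D R X Z) else essInf (fun ω => X ω + Z ω) P

/-- Two random variables are comonotonic: `(f ω - f ω') (g ω - g ω') ≥ 0` for almost all pairs
`(ω, ω')`. -/
def Comonotonic (P : Measure Ω) (f g : Ω → ℝ) : Prop :=
  ∀ᵐ p ∂(P.prod P), 0 ≤ (f p.1 - f p.2) * (g p.1 - g p.2)

/-- `R` is linear (affine) on its domain. -/
def IsLinearOn (D : Set ℝ) (R : ℝ → ℝ) : Prop :=
  ∃ a b : ℝ, ∀ x ∈ D, R x = a * x + b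

/-- `z ∈ [0, ∞) ↦ z exp (-R (𝒳 + z))` is a.s. nondecreasing. -/
def AsNondecreasing (P : Measure Ω) (R : ℝ → ℝ) (X : Lp ℝ ∞ P) : Prop :=
  ∀ᵐ ω ∂P, MonotoneOn (fun z : ℝ => z * Real.exp (-R (X ω + z))) (Ici 0)

/-- `z ∈ [0, ∞) ↦ z exp (-R (𝒳 + z))` is a.s. concave. -/
def AsConcave (P : Measure Ω) (R : ℝ → ℝ) (X : Lp ℝ ∞ P) : Prop :=
  ∀ᵐ ω ∂P, ConcaveOn ℝ (Ici 0) (fun z : ℝ => z * Real.exp (-R (X ω + z)))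

/-- The weak* topology on `L^∞`: the coarsest topology that makes `Y ↦ E[Y' Y]` continuous for
every `Y' ∈ L^1`. -/
@[reducible]
def weakStarTopology (P : Measure Ω) : TopologicalSpace (Lp ℝ ∞ P) :=
  ⨅ Y' : Lp ℝ 1 P, TopologicalSpace.induced (fun Y : Lp ℝ ∞ P => ∫ ω, Y' ω * Y ω ∂P) inferInstance

end EqPricing

end

noncomputable section

namespace EqPricing

variable {Ω : Type*} [MeasurableSpace Ω]

/-! ### Essential bounds of bounded random variables -/

section EssBounds

variable {P : Measure Ω}

/-! Call a price `v` interior if `margin P X Z - v ∈ D`. At such prices the weights are bounded and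
positive, so `v` is a fixed point of `H_Z` exactly when the excess `E[(Z - v) exp (-R (𝒳 + Z - v))]`
vanishes. The excess is jointly continuous in payoff and interior price, positive below `essInf Z`
and negative at interior prices above `essSup Z`.

The intermediate value theorem then gives the pivot `lt_Vbar_iff`: `v < V̄(Z)` iff `v` is interior
and the excess is positive on all of `(-∞, v]`. It covers both branches of the definition of `V̄`
and never evaluates the excess at the boundary price, where the weight may be infinite. Bounds, law
invariance and cash translativity follow from it directly; lower semicontinuity follows with a
compactness argument.

Upper semicontinuity needs the excess to stay negative after it first becomes nonpositive
(`SingleCrossing`). Linear `R` rescales the weights; a nondecreasing gain makes the excess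
nonincreasing in the price; a concave gain is nonnegative on `[0, ∞)`, hence nondecreasing; under
comonotonicity a Chebyshev-type inequality makes `H_Z` nonincreasing at interior prices.

For a nondecreasing gain the pivot only involves the sign at `v`, so monotonicity of `V̄` is
inherited from the integrand. For a concave gain the superlevel condition is convex in `(Z, v)`, and
tangent lines with integrable slopes give weak* upper semicontinuity. -/

theorem ae_abs_le_norm (f : Lp ℝ ∞ P) : ∀ᵐ ω ∂P, |f ω| ≤ ‖f‖ := by
  filter_upwards [enorm_ae_le_eLpNormEssSup f P] with ω hω
  rw [Lp.norm_def, eLpNorm_exponent_top, ← Real.norm_eq_abs, ← toReal_enorm]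
  refine ENNReal.toReal_mono ?_ hω
  rw [← eLpNorm_exponent_top]
  exact Lp.eLpNorm_ne_top f

theorem ae_abs_sub_le_norm (f g : Lp ℝ ∞ P) : ∀ᵐ ω ∂P, |f ω - g ω| ≤ ‖f - g‖ := by
  filter_upwards [ae_abs_le_norm (f - g), Lp.coeFn_sub f g] with ω h1 h2
  rwa [h2] at h1

theorem ae_abs_add_le (X Z : Lp ℝ ∞ P) : ∀ᵐ ω ∂P, |X ω + Z ω| ≤ ‖X‖ + ‖Z‖ := by
  filter_upwards [ae_abs_le_norm X, ae_abs_le_norm Z] with ω h1 h2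
  exact (abs_add_le _ _).trans (add_le_add h1 h2)

variable [IsProbabilityMeasure P]

/-- The bound `C` matters because a real-valued `essInf` is a conditionally complete supremum,
meaningful only for suitably bounded functions. -/
theorem le_essInf_iff_ae {f : Ω → ℝ} {C : ℝ} (hf : ∀ᵐ ω ∂P, |f ω| ≤ C) {c : ℝ} :
    c ≤ essInf f P ↔ ∀ᵐ ω ∂P, c ≤ f ω := by
  have hb : IsBoundedUnder (· ≥ ·) (ae P) f :=
    ⟨-C, by simpa using hf.mono fun ω h => (abs_le.1 h).1⟩
  have hc : IsCoboundedUnder (· ≥ ·) (ae P) f :=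
    IsBoundedUnder.isCoboundedUnder_ge ⟨C, by simpa using hf.mono fun ω h => (abs_le.1 h).2⟩
  refine ⟨fun h => ?_, fun h => le_essInf_of_ae_le c h hc⟩
  filter_upwards [ae_essInf_le hb] with ω hω using h.trans hω

theorem essSup_le_iff_ae {f : Ω → ℝ} {C : ℝ} (hf : ∀ᵐ ω ∂P, |f ω| ≤ C) {c : ℝ} :
    essSup f P ≤ c ↔ ∀ᵐ ω ∂P, f ω ≤ c := by
  have hb : IsBoundedUnder (· ≤ ·) (ae P) f :=
    ⟨C, by simpa using hf.mono fun ω h => (abs_le.1 h).2⟩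
  have hc : IsCoboundedUnder (· ≤ ·) (ae P) f :=
    IsBoundedUnder.isCoboundedUnder_le ⟨-C, by simpa using hf.mono fun ω h => (abs_le.1 h).1⟩
  refine ⟨fun h => ?_, fun h => essSup_le_of_ae_le c h hc⟩
  filter_upwards [ae_le_essSup hb] with ω hω using hω.trans h

theorem ae_essInf_le_coe (Z : Lp ℝ ∞ P) : ∀ᵐ ω ∂P, essInf Z P ≤ Z ω :=
  (le_essInf_iff_ae (ae_abs_le_norm Z)).1 le_rfl

theorem ae_coe_le_essSup (Z : Lp ℝ ∞ P) : ∀ᵐ ω ∂P, Z ω ≤ essSup Z P :=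
  (essSup_le_iff_ae (ae_abs_le_norm Z)).1 le_rfl

/-- The lower end of the aggregate position `𝒳 + Z`. -/
def margin (P : Measure Ω) (X Z : Lp ℝ ∞ P) : ℝ := essInf (fun ω => X ω + Z ω) P

theorem le_margin_iff {X Z : Lp ℝ ∞ P} {c : ℝ} :
    c ≤ margin P X Z ↔ ∀ᵐ ω ∂P, c ≤ X ω + Z ω :=
  le_essInf_iff_ae (ae_abs_add_le X Z)

theorem ae_margin_le (X Z : Lp ℝ ∞ P) : ∀ᵐ ω ∂P, margin P X Z ≤ X ω + Z ω :=
  le_margin_iff.1 le_rfl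

theorem essInf_sub_norm_le (Y Z : Lp ℝ ∞ P) : essInf Y P - ‖Z - Y‖ ≤ essInf Z P := by
  rw [le_essInf_iff_ae (ae_abs_le_norm Z)]
  filter_upwards [ae_essInf_le_coe Y, ae_abs_sub_le_norm Z Y] with ω h1 h2
  linarith [(abs_le.1 h2).1]

theorem margin_sub_norm_le (X Y Z : Lp ℝ ∞ P) : margin P X Y - ‖Z - Y‖ ≤ margin P X Z := by
  rw [le_margin_iff]
  filter_upwards [ae_margin_le X Y, ae_abs_sub_le_norm Z Y] with ω h1 h2
  linarith [(abs_le.1 h2).1]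

theorem continuous_of_sub_norm_le {E : Type*} [SeminormedAddCommGroup E] {f : E → ℝ}
    (h : ∀ Y Z, f Y - ‖Z - Y‖ ≤ f Z) : Continuous f := by
  refine (LipschitzWith.of_le_add fun Y Z => ?_ : LipschitzWith 1 f).continuous
  have := h Y Z
  rw [dist_eq_norm, norm_sub_rev]
  linarith

theorem continuous_essInf : Continuous fun Z : Lp ℝ ∞ P => essInf Z P :=
  continuous_of_sub_norm_le essInf_sub_norm_le

theorem continuous_margin (X : Lp ℝ ∞ P) : Continuous (margin P X) :=
  continuous_of_sub_norm_le (margin_sub_norm_le X)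

theorem essInf_add_essInf_le_margin (X Z : Lp ℝ ∞ P) :
    essInf X P + essInf Z P ≤ margin P X Z := by
  rw [le_margin_iff]
  filter_upwards [ae_essInf_le_coe X, ae_essInf_le_coe Z] with ω h1 h2
  linarith

theorem integral_pos_of_ae_pos {f : Ω → ℝ} (hf : Integrable f P) (h : ∀ᵐ ω ∂P, 0 < f ω) :
    0 < ∫ ω, f ω ∂P := by
  rw [integral_pos_iff_support_of_nonneg_ae (h.mono fun _ h => h.le) hf]
  refine pos_iff_ne_zero.2 fun h0 => ?_
  have h1 : ∀ᵐ ω ∂P, ω ∉ Function.support f := measure_eq_zero_iff_ae_notMem.1 h0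
  obtain ⟨ω, h2, h3⟩ := (h.and h1).exists
  exact h3 h2.ne'

end EssBounds

/-! ### The weight -/

/-- The standing assumptions on the domain and on the function `R`. -/
structure IsProfile (D : Set ℝ) (R : ℝ → ℝ) : Prop where
  dom : D = Set.univ ∨ D = Set.Ioi 0
  mono : StrictMonoOn R D
  diff : DifferentiableOn ℝ R D
  conc : ConcaveOn ℝ D R

namespace IsProfile

variable {D : Set ℝ} {R : ℝ → ℝ} (h : IsProfile D R)
include h

theorem isOpen : IsOpen D := by
  rcases h.dom with rfl | rfl
  exacts [isOpen_univ, isOpen_Ioi]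

theorem mem_of_le {x y : ℝ} (hx : x ∈ D) (hxy : x ≤ y) : y ∈ D := by
  rcases h.dom with rfl | rfl
  exacts [mem_univ _, lt_of_lt_of_le (mem_Ioi.1 hx) hxy]

theorem convex : Convex ℝ D := h.conc.1

theorem continuousOn : ContinuousOn R D := h.diff.continuousOn

theorem convexOn_exp_neg : ConvexOn ℝ D fun x => Real.exp (-R x) := by
  refine ⟨h.convex, fun x hx y hy a b ha hb hab => ?_⟩
  have h1 := h.conc.2 hx hy ha hb hab
  have h2 := convexOn_exp.2 (mem_univ (-R x)) (mem_univ (-R y)) ha hb hab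
  refine le_trans (Real.exp_le_exp.2 ?_) h2
  simp only [smul_eq_mul] at h1 ⊢
  linarith

theorem exp_neg_anti {x y : ℝ} (hx : x ∈ D) (hxy : x ≤ y) :
    Real.exp (-R y) ≤ Real.exp (-R x) :=
  Real.exp_le_exp.2 (neg_le_neg (h.mono.monotoneOn hx (h.mem_of_le hx hxy) hxy))

theorem antitone_weight : Antitone (weight D R) := by
  intro x y hxy
  by_cases hx : x ∈ D
  · have hy := h.mem_of_le hx hxy
    simp only [weight, if_pos hx, if_pos hy]
    exact ENNReal.ofReal_le_ofReal (h.exp_neg_anti hx hxy)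
  · by_cases hy : y ∈ D
    · simp only [weight, if_neg hx, if_pos hy]
      exact le_iSup₂ (f := fun y (_ : y ∈ D) => ENNReal.ofReal (Real.exp (-R y))) y hy
    · simp only [weight, if_neg hx, if_neg hy, le_refl]

theorem measurable_weight : Measurable (weight D R) := h.antitone_weight.measurable

end IsProfile

theorem weight_of_mem {D : Set ℝ} {R : ℝ → ℝ} {x : ℝ} (hx : x ∈ D) :
    weight D R x = ENNReal.ofReal (Real.exp (-R x)) := by
  simp [weight, hx]

theorem toReal_weight {D : Set ℝ} {R : ℝ → ℝ} {x : ℝ} (hx : x ∈ D) :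
    (weight D R x).toReal = Real.exp (-R x) := by
  rw [weight_of_mem hx, ENNReal.toReal_ofReal (Real.exp_pos _).le]

/-! ### The weighted excess of a payoff over a price -/

/-- The numerator of `H_Z(v) - v`, that is `E[(Z - v) exp (-R (𝒳 + Z - v))]`. -/
def excess (P : Measure Ω) (D : Set ℝ) (R : ℝ → ℝ) (X Z : Lp ℝ ∞ P) (v : ℝ) : ℝ :=
  ∫ ω, (Z ω - v) * (weight D R (X ω + Z ω - v)).toReal ∂P

section Excess

variable {P : Measure Ω} {D : Set ℝ} {R : ℝ → ℝ} {X Z : Lp ℝ ∞ P}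
  {u v : ℝ}

theorem margin_sub_mem_of_le (h : IsProfile D R) (hv : margin P X Z - v ∈ D) (huv : u ≤ v) :
    margin P X Z - u ∈ D :=
  h.mem_of_le hv (by linarith)

theorem aestronglyMeasurable_toReal_weight (h : IsProfile D R) (X Z : Lp ℝ ∞ P) (v : ℝ) :
    AEStronglyMeasurable (fun ω => (weight D R (X ω + Z ω - v)).toReal) P := by
  refine (h.measurable_weight.ennreal_toReal.comp_aemeasurable ?_).aestronglyMeasurable
  have hX := (Lp.aestronglyMeasurable X).aemeasurable
  have hZ := (Lp.aestronglyMeasurable Z).aemeasurable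
  exact (hX.add hZ).sub_const v

variable [IsProbabilityMeasure P]

theorem ae_mem (h : IsProfile D R) (hv : margin P X Z - v ∈ D) :
    ∀ᵐ ω ∂P, X ω + Z ω - v ∈ D := by
  filter_upwards [ae_margin_le X Z] with ω hω
  exact h.mem_of_le hv (by linarith)

/-- For such `v` one has `𝒳 + Z - v ≥ 𝒳`; this is how the assumption on `essInf X` supplies interior
prices. -/
theorem margin_sub_mem (h : IsProfile D R) (hX : essInf X P ∈ D) (hv : v ≤ essInf Z P) :
    margin P X Z - v ∈ D :=
  h.mem_of_le hX (by linarith [essInf_add_essInf_le_margin X Z])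

theorem ae_toReal_weight_le (h : IsProfile D R) (hv : margin P X Z - v ∈ D) :
    ∀ᵐ ω ∂P, ‖(weight D R (X ω + Z ω - v)).toReal‖ ≤ Real.exp (-R (margin P X Z - v)) := by
  filter_upwards [ae_margin_le X Z] with ω hω
  rw [Real.norm_of_nonneg ENNReal.toReal_nonneg, toReal_weight (h.mem_of_le hv (by linarith))]
  exact h.exp_neg_anti hv (by linarith)

theorem integrable_toReal_weight (h : IsProfile D R) (hv : margin P X Z - v ∈ D) :
    Integrable (fun ω => (weight D R (X ω + Z ω - v)).toReal) P :=
  Integrable.of_bound (aestronglyMeasurable_toReal_weight h X Z v) _ (ae_toReal_weight_le h hv)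

theorem integrable_mul_toReal_weight (h : IsProfile D R) (Y : Lp ℝ ∞ P)
    (hv : margin P X Z - v ∈ D) :
    Integrable (fun ω => Y ω * (weight D R (X ω + Z ω - v)).toReal) P :=
  (integrable_toReal_weight h hv).bdd_mul (Lp.aestronglyMeasurable Y) (ae_abs_le_norm Y)

theorem integrable_excess (h : IsProfile D R) (hv : margin P X Z - v ∈ D) :
    Integrable (fun ω => (Z ω - v) * (weight D R (X ω + Z ω - v)).toReal) P := by
  simp only [sub_mul]
  exact (integrable_mul_toReal_weight h Z hv).sub ((integrable_toReal_weight h hv).const_mul v)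

theorem excess_eq_sub (h : IsProfile D R) (hv : margin P X Z - v ∈ D) :
    excess P D R X Z v = ∫ ω, Z ω * (weight D R (X ω + Z ω - v)).toReal ∂P -
      v * ∫ ω, (weight D R (X ω + Z ω - v)).toReal ∂P := by
  rw [excess, ← integral_const_mul, ← integral_sub (integrable_mul_toReal_weight h Z hv)
    ((integrable_toReal_weight h hv).const_mul v)]
  simp only [sub_mul]

theorem excess_eq_exp (h : IsProfile D R) (hv : margin P X Z - v ∈ D) :
    excess P D R X Z v = ∫ ω, (Z ω - v) * Real.exp (-R (X ω + Z ω - v)) ∂P := by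
  refine integral_congr_ae ?_
  filter_upwards [ae_mem h hv] with ω hω
  rw [toReal_weight hω]

theorem integrable_excess_exp (h : IsProfile D R) (hv : margin P X Z - v ∈ D) :
    Integrable (fun ω => (Z ω - v) * Real.exp (-R (X ω + Z ω - v))) P := by
  refine (integrable_excess h hv).congr ?_
  filter_upwards [ae_mem h hv] with ω hω
  rw [toReal_weight hω]

theorem integral_toReal_weight_pos (h : IsProfile D R) (hv : margin P X Z - v ∈ D) :
    0 < ∫ ω, (weight D R (X ω + Z ω - v)).toReal ∂P := by
  refine integral_pos_of_ae_pos (integrable_toReal_weight h hv) ?_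
  filter_upwards [ae_mem h hv] with ω hω
  rw [toReal_weight hω]
  exact Real.exp_pos _

theorem feasible_of_margin_sub_mem (h : IsProfile D R) (hv : margin P X Z - v ∈ D) :
    Feasible P D R X Z v := by
  refine ⟨(ae_mem h hv).mono fun ω hω => subset_closure hω, ?_⟩
  calc ∫⁻ ω, weight D R (X ω + Z ω - v) ∂P
      ≤ ∫⁻ _, ENNReal.ofReal (Real.exp (-R (margin P X Z - v))) ∂P := by
        refine lintegral_mono_ae ?_
        filter_upwards [ae_margin_le X Z] with ω hω
        rw [← weight_of_mem hv]
        exact h.antitone_weight (by linarith)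
    _ < ∞ := by simp

/-- At an interior price feasibility is automatic and the denominator of `H` is positive, so the
fixed point equation can be cleared of fractions. -/
theorem mem_V_iff (h : IsProfile D R) (hv : margin P X Z - v ∈ D) :
    v ∈ V P D R X Z ↔ excess P D R X Z v = 0 := by
  have hpos := integral_toReal_weight_pos h hv
  rw [V, mem_ofPred_eq, H, div_eq_iff hpos.ne', excess_eq_sub h hv, sub_eq_zero]
  exact and_iff_right (feasible_of_margin_sub_mem h hv)

theorem le_margin_of_feasible (hf : Feasible P (Ioi 0) R X Z v) : v ≤ margin P X Z := by
  rw [le_margin_iff]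
  filter_upwards [hf.1] with ω hω
  rw [closure_Ioi, mem_Ici] at hω
  linarith

theorem excess_pos_of_lt_essInf (h : IsProfile D R) (hX : essInf X P ∈ D)
    (hv : v < essInf Z P) : 0 < excess P D R X Z v := by
  have hm := margin_sub_mem h hX hv.le
  refine integral_pos_of_ae_pos (integrable_excess h hm) ?_
  filter_upwards [ae_mem h hm, ae_essInf_le_coe Z] with ω h1 h2
  rw [toReal_weight h1]
  exact mul_pos (by linarith) (Real.exp_pos _)

theorem excess_neg_of_essSup_lt (h : IsProfile D R) (hm : margin P X Z - v ∈ D)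
    (hv : essSup Z P < v) : excess P D R X Z v < 0 := by
  rw [← neg_pos, excess, ← integral_neg]
  refine integral_pos_of_ae_pos (integrable_excess h hm).neg ?_
  filter_upwards [ae_mem h hm, ae_coe_le_essSup Z] with ω h1 h2
  rw [toReal_weight h1, ← neg_mul]
  exact mul_pos (by linarith) (Real.exp_pos _)

/-- Dominated convergence along sequences: norm convergence moves the margin continuously, which
keeps the weights uniformly bounded. -/
theorem continuousAt_excess (h : IsProfile D R) (hv : margin P X Z - v ∈ D) :
    ContinuousAt (fun p : Lp ℝ ∞ P × ℝ => excess P D R X p.1 p.2) (Z, v) := by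
  refine tendsto_of_seq_tendsto fun p hp => ?_
  have hp1 : Tendsto (fun n => (p n).1) atTop (𝓝 Z) := (continuous_fst.tendsto _).comp hp
  have hp2 : Tendsto (fun n => (p n).2) atTop (𝓝 v) := (continuous_snd.tendsto _).comp hp
  -- As `D` is open there is room below the margin; eventually all arguments of the weight exceed
  -- `δ`, so `exp (-R δ)` dominates it.
  obtain ⟨δ, hδ, hδD⟩ : ∃ δ < margin P X Z - v, δ ∈ D := by
    have := (h.isOpen.mem_nhds hv)
    obtain ⟨ε, hε, hs⟩ := Metric.mem_nhds_iff.1 this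
    exact ⟨margin P X Z - v - ε / 2, by linarith, hs (by
      rw [Metric.mem_ball, Real.dist_eq, sub_sub_cancel_left, abs_neg, abs_of_pos (by linarith)]
      linarith)⟩
  have hmarg : Tendsto (fun n => margin P X (p n).1 - (p n).2) atTop
      (𝓝 (margin P X Z - v)) := ((continuous_margin X).tendsto Z |>.comp hp1).sub hp2
  have hdist : Tendsto (fun n => ‖(p n).1 - Z‖) atTop (𝓝 0) :=
    tendsto_iff_norm_sub_tendsto_zero.1 hp1
  have hae : ∀ᵐ ω ∂P, ∀ n, |(p n).1 ω - Z ω| ≤ ‖(p n).1 - Z‖ :=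
    ae_all_iff.2 fun n => ae_abs_sub_le_norm _ _
  refine tendsto_integral_filter_of_dominated_convergence
    (fun _ => (‖Z‖ + 1 + (|v| + 1)) * Real.exp (-R δ)) ?_ ?_ (integrable_const _) ?_
  · exact Eventually.of_forall fun n => ((Lp.aestronglyMeasurable _).sub
      aestronglyMeasurable_const).mul (aestronglyMeasurable_toReal_weight h X _ _)
  · filter_upwards [hmarg.eventually_const_lt hδ, hdist.eventually_lt_const one_pos,
      (hp2.abs).eventually_lt_const (lt_add_one |v|)] with n h1 h2 h3
    filter_upwards [hae, ae_abs_le_norm Z, ae_margin_le X (p n).1] with ω h4 h5 h6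
    have h7 : δ ≤ X ω + (p n).1 ω - (p n).2 := by linarith
    rw [norm_mul, Real.norm_of_nonneg ENNReal.toReal_nonneg, toReal_weight (h.mem_of_le hδD h7)]
    refine mul_le_mul ?_ (h.exp_neg_anti hδD h7) (Real.exp_pos _).le (by positivity)
    rw [Real.norm_eq_abs]
    have h8 := h4 n
    have h9 := abs_sub ((p n).1 ω) (p n).2
    have h10 : |(p n).1 ω| ≤ |(p n).1 ω - Z ω| + |Z ω| := by
      simpa using abs_add_le ((p n).1 ω - Z ω) (Z ω)
    linarith
  · filter_upwards [hae, ae_mem h hv] with ω h1 h2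
    have h3 : Tendsto (fun n => (p n).1 ω) atTop (𝓝 (Z ω)) :=
      tendsto_iff_norm_sub_tendsto_zero.2
        (squeeze_zero (fun _ => norm_nonneg _) (fun n => h1 n) hdist)
    have h4 : Tendsto (fun n => X ω + (p n).1 ω - (p n).2) atTop (𝓝 (X ω + Z ω - v)) :=
      (tendsto_const_nhds.add h3).sub hp2
    rw [toReal_weight h2]
    have h5 : ContinuousAt R (X ω + Z ω - v) := h.continuousOn.continuousAt (h.isOpen.mem_nhds h2)
    have h6 := (Real.continuous_exp.tendsto _).comp ((h5.tendsto.comp h4).neg)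
    refine (h3.sub hp2).mul (h6.congr' ?_)
    filter_upwards [h4.eventually (h.isOpen.mem_nhds h2)] with n hn
    rw [toReal_weight hn]
    rfl

theorem continuousAt_excess_price (h : IsProfile D R) (hv : margin P X Z - v ∈ D) :
    ContinuousAt (excess P D R X Z) v :=
  ContinuousAt.comp (f := fun w : ℝ => (Z, w)) (continuousAt_excess h hv) (by fun_prop)

end Excess

/-! ### Characterization of the selection by the sign of the excess -/

section Selection

variable {P : Measure Ω} [IsProbabilityMeasure P] {D : Set ℝ} {R : ℝ → ℝ} {X Z : Lp ℝ ∞ P}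
  {u v : ℝ}

theorem essInf_le_of_excess_nonpos (h : IsProfile D R) (hX : essInf X P ∈ D)
    (hv : excess P D R X Z v ≤ 0) : essInf Z P ≤ v :=
  not_lt.1 fun hlt => (excess_pos_of_lt_essInf h hX hlt).not_ge hv

/-- If the excess at an interior price is nonpositive, then there is a zero below. -/
theorem exists_mem_V_le (h : IsProfile D R) (hX : essInf X P ∈ D)
    (hm : margin P X Z - v ∈ D) (hv : excess P D R X Z v ≤ 0) : ∃ u ≤ v, u ∈ V P D R X Z := by
  have ha : essInf Z P - 1 ≤ v := by linarith [essInf_le_of_excess_nonpos h hX hv]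
  have hc : ContinuousOn (excess P D R X Z) (Icc (essInf Z P - 1) v) := fun w hw =>
    (continuousAt_excess_price h (margin_sub_mem_of_le h hm hw.2)).continuousWithinAt
  obtain ⟨u, hu, hu0⟩ := intermediate_value_Icc' ha hc
    ⟨hv, (excess_pos_of_lt_essInf h hX (sub_one_lt _)).le⟩
  exact ⟨u, hu.2, (mem_V_iff h (margin_sub_mem_of_le h hm hu.2)).2 hu0⟩

theorem essInf_le_of_mem_V (h : IsProfile D R) (hX : essInf X P ∈ D)
    (hv : v ∈ V P D R X Z) : essInf Z P ≤ v := by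
  by_contra! hlt
  have := (mem_V_iff h (margin_sub_mem h hX hlt.le)).1 hv
  exact (excess_pos_of_lt_essInf h hX hlt).ne' this

theorem bddBelow_V (h : IsProfile D R) (hX : essInf X P ∈ D) (Z : Lp ℝ ∞ P) :
    BddBelow (V P D R X Z) :=
  ⟨essInf Z P, fun _ hv => essInf_le_of_mem_V h hX hv⟩

theorem margin_sub_mem_of_lt_of_mem_V (h : IsProfile D R) (hv : v ∈ V P D R X Z) (huv : u < v) :
    margin P X Z - u ∈ D := by
  rcases h.dom with rfl | rfl
  · exact mem_univ _
  · exact sub_pos.2 (huv.trans_le (le_margin_of_feasible hv.1))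

/-- An infimum that is not attained lies strictly below some price, hence is interior. There the
excess is continuous and nonzero, so no prices can accumulate. -/
theorem isLeast_sInf_V (h : IsProfile D R) (hX : essInf X P ∈ D)
    (hne : (V P D R X Z).Nonempty) : IsLeast (V P D R X Z) (sInf (V P D R X Z)) := by
  have hb := bddBelow_V h hX Z
  refine ⟨?_, fun v hv => csInf_le hb hv⟩
  by_contra hmem
  obtain ⟨v, hv⟩ := hne
  have hlt : sInf (V P D R X Z) < v :=
    lt_of_le_of_ne (csInf_le hb hv) fun he => hmem (he ▸ hv)
  have hm := margin_sub_mem_of_lt_of_mem_V h hv hlt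
  have hpos : ∀ᶠ w in 𝓝 (sInf (V P D R X Z)), excess P D R X Z w ≠ 0 ∧ w < v :=
    ((continuousAt_excess_price h hm).eventually_ne fun h0 => hmem ((mem_V_iff h hm).2 h0)).and
      (eventually_lt_nhds hlt)
  have hcl := csInf_mem_closure ⟨v, hv⟩ hb
  obtain ⟨w, ⟨hw1, hw2⟩, hwV⟩ := mem_closure_iff_nhds.1 hcl _ hpos
  exact hw1 ((mem_V_iff h (margin_sub_mem_of_lt_of_mem_V h hv hw2)).1 hwV)

theorem isLeast_Vbar (h : IsProfile D R) (hX : essInf X P ∈ D)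
    (hne : (V P D R X Z).Nonempty) : IsLeast (V P D R X Z) (Vbar P D R X Z) := by
  rw [Vbar, if_pos hne]
  exact isLeast_sInf_V h hX hne

/-- A nonpositive excess at an interior price forces a price at or below it. If there is no price at
all, the excess is therefore positive at every interior price; this is impossible on `ℝ`, and on
`(0, ∞)` the interior prices are those below the margin. -/
theorem lt_Vbar_iff (h : IsProfile D R) (hX : essInf X P ∈ D) :
    v < Vbar P D R X Z ↔ margin P X Z - v ∈ D ∧ ∀ u ≤ v, 0 < excess P D R X Z u := by
  by_cases hne : (V P D R X Z).Nonempty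
  · have hl := isLeast_Vbar h hX hne
    constructor
    · intro hv
      refine ⟨margin_sub_mem_of_lt_of_mem_V h hl.1 hv, fun u hu => ?_⟩
      by_contra! hle
      obtain ⟨w, hwu, hw⟩ := exists_mem_V_le h hX
        (margin_sub_mem_of_lt_of_mem_V h hl.1 (hu.trans_lt hv)) hle
      linarith [hl.2 hw]
    · rintro ⟨hm, hpos⟩
      by_contra! hle
      exact (hpos _ hle).ne' ((mem_V_iff h (margin_sub_mem_of_le h hm hle)).1 hl.1)
  · have hVbar : Vbar P D R X Z = margin P X Z := by rw [Vbar, if_neg hne, margin]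
    have hpos : ∀ u, margin P X Z - u ∈ D → 0 < excess P D R X Z u := fun u hu => by
      by_contra! hle
      obtain ⟨w, -, hw⟩ := exists_mem_V_le h hX hu hle
      exact hne ⟨w, hw⟩
    rcases h.dom with rfl | rfl
    · have h1 := hpos (essSup Z P + 1) (mem_univ _)
      exact absurd h1 (excess_neg_of_essSup_lt h (mem_univ _) (lt_add_one _)).not_gt
    · rw [hVbar]
      refine ⟨fun hv => ⟨sub_pos.2 hv, fun u hu => hpos u (sub_pos.2 (hu.trans_lt hv))⟩,
        fun hv => sub_pos.1 hv.1⟩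

theorem Vbar_le_of_excess_nonpos (h : IsProfile D R) (hX : essInf X P ∈ D)
    (hv : excess P D R X Z v ≤ 0) : Vbar P D R X Z ≤ v :=
  not_lt.1 fun hlt => (((lt_Vbar_iff h hX).1 hlt).2 v le_rfl).not_ge hv

theorem Vbar_le_of_margin_sub_notMem (h : IsProfile D R) (hX : essInf X P ∈ D)
    (hv : margin P X Z - v ∉ D) : Vbar P D R X Z ≤ v :=
  not_lt.1 fun hlt => hv ((lt_Vbar_iff h hX).1 hlt).1

theorem excess_Vbar_nonpos (h : IsProfile D R) (hX : essInf X P ∈ D)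
    (hm : margin P X Z - Vbar P D R X Z ∈ D) : excess P D R X Z (Vbar P D R X Z) ≤ 0 := by
  by_contra! hpos
  refine lt_irrefl (Vbar P D R X Z) ((lt_Vbar_iff h hX).2 ⟨hm, fun u hu => ?_⟩)
  rcases hu.eq_or_lt with rfl | hu
  · exact hpos
  · exact ((lt_Vbar_iff h hX).1 hu).2 u le_rfl

/-! ### Elementary properties of the selection -/

theorem Vbar_mem_Icc (h : IsProfile D R) (hX : essInf X P ∈ D) (Z : Lp ℝ ∞ P) :
    Vbar P D R X Z ∈ Icc (essInf Z P) (essSup Z P) := by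
  constructor
  · refine le_of_forall_lt fun v hv => (lt_Vbar_iff h hX).2 ⟨margin_sub_mem h hX hv.le, ?_⟩
    exact fun u hu => excess_pos_of_lt_essInf h hX (hu.trans_lt hv)
  · refine le_of_forall_gt_imp_ge_of_dense fun v hv => not_lt.1 fun hlt => ?_
    obtain ⟨hm, hpos⟩ := (lt_Vbar_iff h hX).1 hlt
    exact (hpos v le_rfl).not_gt (excess_neg_of_essSup_lt h hm hv)

/-- By `lt_Vbar_iff` the selection depends only on the margin and the excess, both determined by the
joint law. -/
theorem Vbar_congr_law (h : IsProfile D R) (hX : essInf X P ∈ D) {Z₁ Z₂ : Lp ℝ ∞ P}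
    (hid : IdentDistrib (fun ω => (Z₁ ω, X ω + Z₁ ω)) (fun ω => (Z₂ ω, X ω + Z₂ ω)) P P) :
    Vbar P D R X Z₁ = Vbar P D R X Z₂ := by
  have hmargin : margin P X Z₁ = margin P X Z₂ := by
    refine eq_of_forall_le_iff fun c => ?_
    rw [le_margin_iff, le_margin_iff]
    exact ⟨fun hc => (hid.comp measurable_snd).ae_snd (p := fun x => c ≤ x) measurableSet_Ici hc,
      fun hc => (hid.comp measurable_snd).symm.ae_snd (p := fun x => c ≤ x) measurableSet_Ici hc⟩
  have hexcess : ∀ u, excess P D R X Z₁ u = excess P D R X Z₂ u := fun u =>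
    (hid.comp (u := fun p : ℝ × ℝ => (p.1 - u) * (weight D R (p.2 - u)).toReal)
      ((measurable_fst.sub_const u).mul
        (h.measurable_weight.comp (measurable_snd.sub_const u)).ennreal_toReal)).integral_eq
  refine eq_of_forall_lt_iff fun c => ?_
  rw [lt_Vbar_iff h hX, lt_Vbar_iff h hX, hmargin]
  simp only [hexcess]

theorem ae_add_const (Z : Lp ℝ ∞ P) (z : ℝ) :
    ∀ᵐ ω ∂P, (Z + Lp.const ∞ P z : Lp ℝ ∞ P) ω = Z ω + z := by
  filter_upwards [Lp.coeFn_add Z (Lp.const ∞ P z), Lp.coeFn_const (p := ∞) (μ := P) z]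
    with ω h1 h2
  rw [h1, Pi.add_apply, h2, Function.const_apply]

theorem Vbar_add_const (h : IsProfile D R) (hX : essInf X P ∈ D) (Z : Lp ℝ ∞ P) (z : ℝ) :
    Vbar P D R X (Z + Lp.const ∞ P z) = Vbar P D R X Z + z := by
  have hmargin : ∀ c, margin P X (Z + Lp.const ∞ P z) - c = margin P X Z - (c - z) := by
    intro c
    have : margin P X (Z + Lp.const ∞ P z) = margin P X Z + z := by
      refine eq_of_forall_le_iff fun c => ?_
      rw [← sub_le_iff_le_add, le_margin_iff, le_margin_iff]
      refine eventually_congr ?_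
      filter_upwards [ae_add_const Z z] with ω hω
      rw [hω, ← add_assoc, sub_le_iff_le_add]
    rw [this]
    ring
  have hexcess : ∀ u, excess P D R X (Z + Lp.const ∞ P z) u = excess P D R X Z (u - z) := by
    intro u
    refine integral_congr_ae ?_
    filter_upwards [ae_add_const Z z] with ω hω
    rw [hω]
    ring_nf
  refine eq_of_forall_lt_iff fun c => ?_
  rw [← sub_lt_iff_lt_add, lt_Vbar_iff h hX, lt_Vbar_iff h hX, hmargin]
  simp only [hexcess]
  refine and_congr_right fun _ => ⟨fun hc u hu => ?_, fun hc u hu => hc _ (by linarith)⟩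
  simpa using hc (u + z) (by linarith)

/-! ### Semicontinuity and continuity of the selection. -/

theorem lowerSemicontinuous_Vbar (h : IsProfile D R) (hX : essInf X P ∈ D) :
    LowerSemicontinuous (Vbar P D R X) := by
  intro Z v hv
  obtain ⟨hm, hpos⟩ := (lt_Vbar_iff h hX).1 hv
  -- Only a compact range of prices needs control: below `essInf Y`, which for `Y` near `Z` exceeds
  -- `essInf Z - 1`, positivity is automatic.
  have hcompact : ∀ᶠ Y in 𝓝 Z, ∀ u ∈ Icc (essInf Z P - 1) v, 0 < excess P D R X Y u := by
    refine isCompact_Icc.eventually_forall_of_forall_eventually fun u hu => ?_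
    exact (continuousAt_excess h (margin_sub_mem_of_le h hm hu.2)).eventually
      (lt_mem_nhds (hpos u hu.2))
  have hmargin : ∀ᶠ Y in 𝓝 Z, margin P X Y - v ∈ D :=
    ((continuous_margin X).sub continuous_const).continuousAt.eventually (h.isOpen.mem_nhds hm)
  filter_upwards [hcompact, hmargin,
    continuous_essInf.continuousAt.eventually (lt_mem_nhds (sub_one_lt (essInf Z P)))]
    with Y h1 h2 h3
  refine (lt_Vbar_iff h hX).2 ⟨h2, fun u hu => ?_⟩
  rcases lt_or_ge u (essInf Y P) with h4 | h4
  · exact excess_pos_of_lt_essInf h hX h4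
  · exact h1 u ⟨h3.le.trans h4, hu⟩

/-- The excess changes sign at most once at `Z`. -/
def SingleCrossing (P : Measure Ω) (D : Set ℝ) (R : ℝ → ℝ) (X Z : Lp ℝ ∞ P) : Prop :=
  ∀ ⦃u v : ℝ⦄, u < v → margin P X Z - v ∈ D → excess P D R X Z u ≤ 0 → excess P D R X Z v < 0

theorem excess_neg_of_Vbar_lt (h : IsProfile D R) (hX : essInf X P ∈ D)
    (hs : SingleCrossing P D R X Z) (hm : margin P X Z - v ∈ D) (hv : Vbar P D R X Z < v) :
    excess P D R X Z v < 0 :=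
  hs hv hm (excess_Vbar_nonpos h hX (margin_sub_mem_of_le h hm hv.le))

/-- Semicontinuity from above along a filter: the margin and, at interior prices, the excess have
to be semicontinuous. -/
theorem eventually_Vbar_lt (h : IsProfile D R) (hX : essInf X P ∈ D)
    (hs : SingleCrossing P D R X Z) {l : Filter (Lp ℝ ∞ P)}
    (hl : ∀ c, margin P X Z < c → ∀ᶠ Y in l, margin P X Y < c)
    (hl' : ∀ u, margin P X Z - u ∈ D → excess P D R X Z u < 0 →
      ∀ᶠ Y in l, margin P X Y - u ∈ D → excess P D R X Y u < 0)
    {c : ℝ} (hc : Vbar P D R X Z < c) : ∀ᶠ Y in l, Vbar P D R X Y < c := by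
  obtain ⟨v, hv, hvc⟩ := exists_between hc
  by_cases hm : margin P X Z - v ∈ D
  · filter_upwards [hl' v hm (excess_neg_of_Vbar_lt h hX hs hm hv)] with Y hY
    refine lt_of_le_of_lt ?_ hvc
    by_cases hmY : margin P X Y - v ∈ D
    · exact Vbar_le_of_excess_nonpos h hX (hY hmY).le
    · exact Vbar_le_of_margin_sub_notMem h hX hmY
  -- Since `v` is not interior for `Z`, a rise of the margin by less than `w - v` leaves `w` outside
  -- the interior prices of `Y`.
  · obtain ⟨w, hvw, hwc⟩ := exists_between hvc
    filter_upwards [hl (margin P X Z + (w - v)) (by linarith)] with Y hY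
    refine lt_of_le_of_lt ?_ hwc
    exact Vbar_le_of_margin_sub_notMem h hX fun hmY => hm (h.mem_of_le hmY (by linarith))

theorem continuousAt_Vbar (h : IsProfile D R) (hX : essInf X P ∈ D)
    (hs : SingleCrossing P D R X Z) : ContinuousAt (Vbar P D R X) Z := by
  refine continuousAt_iff_lower_upperSemicontinuousAt.2
    ⟨lowerSemicontinuous_Vbar h hX Z, fun c hc => eventually_Vbar_lt h hX hs ?_ ?_ hc⟩
  · exact fun c hc => (continuous_margin X).continuousAt.eventually (gt_mem_nhds hc)
  · intro u hu hneg
    have hcont : ContinuousAt (fun Y => excess P D R X Y u) Z :=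
      ContinuousAt.comp (f := fun Y => (Y, u)) (continuousAt_excess h hu) (by fun_prop)
    exact (hcont.eventually (gt_mem_nhds hneg)).mono fun Y hY _ => hY

end Selection

/-! ### Auxiliary facts on concave functions -/

section Concave

/-- Both middle points are convex combinations of the end points, with the two weights exchanged;
the two concavity inequalities add up. -/
theorem ConcaveOn.add_le_add_of_nonneg {S : Set ℝ} {f : ℝ → ℝ} (hf : ConcaveOn ℝ S f)
    {s p q : ℝ} (hp : 0 ≤ p) (hq : 0 < q) (hs : s ∈ S) (hs' : s + p + q ∈ S) :
    f s + f (s + p + q) ≤ f (s + p) + f (s + q) := by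
  have hpq : 0 < p + q := by linarith
  have hsum : q / (p + q) + p / (p + q) = 1 := by field_simp; ring
  have h1 := hf.2 hs hs' (div_nonneg hq.le hpq.le) (div_nonneg hp hpq.le) hsum
  have h2 := hf.2 hs hs' (div_nonneg hp hpq.le) (div_nonneg hq.le hpq.le) (by linarith)
  have e1 : q / (p + q) * s + p / (p + q) * (s + p + q) = s + p := by field_simp; ring
  have e2 : p / (p + q) * s + q / (p + q) * (s + p + q) = s + q := by field_simp; ring
  simp only [smul_eq_mul, e1, e2] at h1 h2
  have h3 : q / (p + q) * f s + p / (p + q) * f s = f s := by rw [← add_mul, hsum, one_mul]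
  have h4 : q / (p + q) * f (s + p + q) + p / (p + q) * f (s + p + q) = f (s + p + q) := by
    rw [← add_mul, hsum, one_mul]
  linarith

theorem ConcaveOn.monotoneOn_Ici_of_nonneg {f : ℝ → ℝ} (hf : ConcaveOn ℝ (Ici 0) f)
    (hpos : ∀ x ∈ Ici (0 : ℝ), 0 ≤ f x) : MonotoneOn f (Ici 0) := by
  intro x hx y hy hxy
  by_contra! hlt
  have hxy' : x < y := lt_of_le_of_ne hxy fun he => hlt.ne (by rw [he])
  have hd : 0 < (f x - f y) / (y - x) := div_pos (by linarith) (by linarith)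
  set d := (f x - f y) / (y - x) with hd_def
  -- Past `y` the graph lies below the chord line of slope `-d`, which reaches the value `-1` after
  -- this step.
  have hstep : 0 < (f y + 1) / d := div_pos (by linarith [hpos y hy]) hd
  have hz : y + (f y + 1) / d ∈ Ici (0 : ℝ) := mem_Ici.2 (by linarith [mem_Ici.1 hy])
  have h1 := hf.slope_anti_adjacent hx hz hxy' (lt_add_of_pos_right y hstep)
  have h2 : (f y - f x) / (y - x) = -d := by rw [hd_def, ← neg_div, neg_sub]
  rw [h2, add_sub_cancel_left, div_le_iff₀ hstep, neg_mul, mul_div_cancel₀ _ hd.ne'] at h1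
  linarith [hpos _ hz]

theorem ConcaveOn.le_add_mul_sub {S : Set ℝ} {f : ℝ → ℝ} (hf : ConcaveOn ℝ S f) {x y f' : ℝ}
    (hx : x ∈ S) (hy : y ∈ S) (hd : HasDerivAt f f' x) : f y ≤ f x + f' * (y - x) := by
  rcases lt_trichotomy x y with hxy | rfl | hxy
  · have h1 := hf.slope_le_of_hasDerivAt hx hy hxy hd
    rw [slope_def_field, div_le_iff₀ (sub_pos.2 hxy)] at h1
    linarith
  · simp
  · have h1 := hf.le_slope_of_hasDerivAt hy hx hxy hd
    rw [slope_def_field, le_div_iff₀ (sub_pos.2 hxy)] at h1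
    linarith

end Concave

/-! ### The pointwise integrand -/

/-- The map `z ↦ z exp (-R (x + z))`. -/
def gain (R : ℝ → ℝ) (x z : ℝ) : ℝ := z * Real.exp (-R (x + z))

theorem gain_nonneg (R : ℝ → ℝ) (x : ℝ) {z : ℝ} (hz : 0 ≤ z) : 0 ≤ gain R x z :=
  mul_nonneg hz (Real.exp_pos _).le

section Gain

variable {D : Set ℝ} {R : ℝ → ℝ} {x z z' : ℝ}

/-- For negative arguments monotonicity is free: a negative increasing factor times a positive
nonincreasing one. -/
theorem gain_le_gain (h : IsProfile D R) (hmono : MonotoneOn (gain R x) (Ici 0))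
    (hz : x + z ∈ D) (hzz : z ≤ z') : gain R x z ≤ gain R x z' := by
  rcases le_or_gt 0 z with h0 | h0
  · exact hmono h0 (h0.trans hzz) hzz
  · have hpos := Real.exp_pos (-R (x + z))
    rcases le_or_gt 0 z' with h1 | h1
    · exact (mul_nonpos_of_nonpos_of_nonneg h0.le hpos.le).trans (gain_nonneg R x h1)
    · exact (mul_le_mul_of_nonneg_right hzz hpos.le).trans
        (mul_le_mul_of_nonpos_left (h.exp_neg_anti hz (by linarith)) h1.le)

theorem gain_lt_gain_of_neg (h : IsProfile D R) (hz : x + z ∈ D) (hzz : z < z') (h0 : z < 0) :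
    gain R x z < gain R x z' := by
  have hpos := Real.exp_pos (-R (x + z))
  rcases le_or_gt 0 z' with h1 | h1
  · exact (mul_neg_of_neg_of_pos h0 hpos).trans_le (gain_nonneg R x h1)
  · exact (mul_lt_mul_of_pos_right hzz hpos).trans_le
      (mul_le_mul_of_nonpos_left (h.exp_neg_anti hz (by linarith)) h1.le)

/-- Concavity extends to negative arguments since `exp (-R)` is convex and nonincreasing. The cases
follow the sign of the convex combination and of its left end point. -/
theorem concaveOn_gain (h : IsProfile D R) (hconc : ConcaveOn ℝ (Ici 0) (gain R x)) :
    ConcaveOn ℝ {z | x + z ∈ D} (gain R x) := by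
  have hcvx : ∀ ⦃y z a b : ℝ⦄, a + b = 1 → x + (a * y + b * z) = a * (x + y) + b * (x + z) := by
    intro y z a b hab
    linear_combination (-x) * hab
  have hset : Convex ℝ {z | x + z ∈ D} := fun y hy z hz a b ha hb hab => by
    simp only [smul_eq_mul, mem_ofPred_eq, hcvx hab]
    exact h.convex hy hz ha hb hab
  refine ⟨hset, fun y hy z hz a b ha hb hab => ?_⟩
  wlog hyz : y ≤ z generalizing y z a b
  · rw [add_comm (a • y), add_comm (a • gain R x y)]
    exact this z hz y hy b a hb ha (by rwa [add_comm]) (le_of_not_ge hyz)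
  have ht := hset hy hz ha hb hab
  simp only [smul_eq_mul, mem_ofPred_eq] at hy hz ht ⊢
  have hexp := h.exp_neg_anti hy (by linarith : x + y ≤ x + z)
  rcases le_or_gt (a * y + b * z) 0 with h0 | h0
  · have h1 := h.convexOn_exp_neg.2 hy hz ha hb hab
    simp only [smul_eq_mul, ← hcvx hab] at h1
    have h2 := mul_le_mul_of_nonpos_left h1 h0
    refine le_trans ?_ h2
    simp only [gain]
    -- The remaining gap equals `a b (z - y)` times the decrease of `exp (-R)` from `x + y` to `x +
    -- z`.
    have h3 := mul_nonneg (mul_nonneg ha hb)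
      (mul_nonneg (sub_nonneg.2 hyz) (sub_nonneg.2 hexp))
    have hb' : b = 1 - a := by linarith
    subst hb'
    nlinarith [h3]
  · rcases le_or_gt 0 y with hy0 | hy0
    · exact hconc.2 hy0 (hy0.trans hyz) ha hb hab
    · have hz0 : 0 < z := by
        by_contra! hz0
        nlinarith
      have htz : a * y + b * z ≤ z := by nlinarith
      have hs : (a * y + b * z) / z ≤ 1 := (div_le_one hz0).2 htz
      -- With `y` negative, compare on `[0, z]` instead: the gain vanishes at `0`, so the gain at
      -- the combination is at least the combination times `exp (-R (x + z))`.
      have h1 := hconc.2 (mem_Ici.2 le_rfl) hz0.le (sub_nonneg.2 hs)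
        (div_nonneg h0.le hz0.le) (by ring)
      simp only [smul_eq_mul, mul_zero, zero_add, div_mul_cancel₀ _ hz0.ne'] at h1
      have h2 : (1 - (a * y + b * z) / z) * gain R x 0 + (a * y + b * z) / z * gain R x z
          = (a * y + b * z) * Real.exp (-R (x + z)) := by
        simp only [gain]
        field_simp
        ring
      rw [h2] at h1
      refine le_trans ?_ h1
      simp only [gain]
      have h3 := mul_le_mul_of_nonpos_left hexp (mul_nonpos_of_nonneg_of_nonpos ha hy0.le)
      nlinarith [h3]

theorem hasDerivAt_gain (h : IsProfile D R) (hz : x + z ∈ D) :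
    HasDerivAt (gain R x) (Real.exp (-R (x + z)) * (1 - z * deriv R (x + z))) z := by
  have h1 : HasDerivAt R (deriv R (x + z)) (x + z) :=
    (h.diff.differentiableAt (h.isOpen.mem_nhds hz)).hasDerivAt
  have h2 : HasDerivAt (fun z => R (x + z)) (deriv R (x + z)) z := h1.comp_const_add x z
  refine ((hasDerivAt_id' z).mul h2.neg.exp).congr_deriv ?_
  simp only [Pi.neg_apply]
  ring

theorem IsProfile.deriv_nonneg (h : IsProfile D R) (hx : x ∈ D) : 0 ≤ deriv R x := by
  have h1 : derivWithin R D x = deriv R x := derivWithin_of_isOpen h.isOpen hx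
  exact h1 ▸ h.mono.monotoneOn.derivWithin_nonneg

theorem IsProfile.deriv_le_deriv (h : IsProfile D R) {y : ℝ} (hx : x ∈ D) (hxy : x ≤ y) :
    deriv R y ≤ deriv R x :=
  h.conc.antitoneOn_deriv (fun _ hw => h.diff.differentiableAt (h.isOpen.mem_nhds hw)) hx
    (h.mem_of_le hx hxy) hxy

end Gain

/-! ### Conditions that force a single crossing. -/

section Conditions

variable {P : Measure Ω} [IsProbabilityMeasure P] {D : Set ℝ} {R : ℝ → ℝ} {X Z : Lp ℝ ∞ P}
  {u v : ℝ}

theorem ae_add_sub_mem (h : IsProfile D R) (hv : margin P X Z - v ∈ D) :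
    ∀ᵐ ω ∂P, X ω + (Z ω - v) ∈ D := by
  simpa only [add_sub_assoc] using ae_mem h hv

theorem excess_eq_gain (h : IsProfile D R) (hv : margin P X Z - v ∈ D) :
    excess P D R X Z v = ∫ ω, gain R (X ω) (Z ω - v) ∂P := by
  simp only [excess_eq_exp h hv, gain, add_sub_assoc]

theorem integrable_gain (h : IsProfile D R) (hv : margin P X Z - v ∈ D) :
    Integrable (fun ω => gain R (X ω) (Z ω - v)) P := by
  simpa only [gain, add_sub_assoc] using integrable_excess_exp h hv

omit [IsProbabilityMeasure P] in
theorem AsConcave.asNondecreasing (hc : AsConcave P R X) : AsNondecreasing P R X :=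
  hc.mono fun ω hω => ConcaveOn.monotoneOn_Ici_of_nonneg hω fun _ hz => gain_nonneg R (X ω) hz

theorem excess_mono (h : IsProfile D R) (hn : AsNondecreasing P R X)
    {Z₁ Z₂ : Lp ℝ ∞ P} (hu : margin P X Z₁ - u ∈ D) (hv : margin P X Z₂ - v ∈ D)
    (hle : ∀ᵐ ω ∂P, Z₁ ω - u ≤ Z₂ ω - v) : excess P D R X Z₁ u ≤ excess P D R X Z₂ v := by
  rw [excess_eq_gain h hu, excess_eq_gain h hv]
  refine integral_mono_ae (integrable_gain h hu) (integrable_gain h hv) ?_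
  filter_upwards [hn, hle, ae_add_sub_mem h hu] with ω h1 h2 h3
  exact gain_le_gain h h1 h3 h2

theorem AsNondecreasing.singleCrossing (h : IsProfile D R)
    (hn : AsNondecreasing P R X) (Z : Lp ℝ ∞ P) : SingleCrossing P D R X Z := by
  intro u v huv hv hu0
  have hu := margin_sub_mem_of_le h hv huv.le
  have hle : excess P D R X Z v ≤ excess P D R X Z u :=
    excess_mono h hn hv hu (Eventually.of_forall fun ω => by linarith)
  by_contra! hv0
  have hu1 : excess P D R X Z u = 0 := le_antisymm hu0 (hv0.trans hle)
  have hv1 : excess P D R X Z v = 0 := le_antisymm (hle.trans hu0) hv0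
  have hdiff : ∫ ω, (gain R (X ω) (Z ω - u) - gain R (X ω) (Z ω - v)) ∂P = 0 := by
    rw [integral_sub (integrable_gain h hu) (integrable_gain h hv), ← excess_eq_gain h hu,
      ← excess_eq_gain h hv, hu1, hv1, sub_zero]
  have hnonneg : 0 ≤ᵐ[P] fun ω => gain R (X ω) (Z ω - u) - gain R (X ω) (Z ω - v) := by
    filter_upwards [hn, ae_add_sub_mem h hv] with ω h1 h2
    exact sub_nonneg.2 (gain_le_gain h h1 h2 (by linarith))
  have hzero := (integral_eq_zero_iff_of_nonneg_ae hnonneg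
    ((integrable_gain h hu).sub (integrable_gain h hv))).1 hdiff
  refine (integral_pos_of_ae_pos (integrable_gain h hu) ?_).ne'
    (by rw [← excess_eq_gain h hu, hu1])
  -- Two equal zeros make the gains agree a.s.; strict monotonicity for negative arguments gives `Z
  -- ≥ v > u`, so the excess at `u` is positive, a contradiction.
  filter_upwards [hzero, ae_add_sub_mem h hv] with ω h1 h2
  have h3 : 0 ≤ Z ω - v := by
    by_contra! h4
    exact (gain_lt_gain_of_neg h h2 (by linarith : Z ω - v < Z ω - u) h4).ne'
      (sub_eq_zero.1 h1)
  exact mul_pos (by linarith) (Real.exp_pos _)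

theorem IsLinearOn.singleCrossing (h : IsProfile D R) (hl : IsLinearOn D R)
    (Z : Lp ℝ ∞ P) : SingleCrossing P D R X Z := by
  obtain ⟨a, b, hab⟩ := hl
  intro u v huv hv hu0
  have hu := margin_sub_mem_of_le h hv huv.le
  have hpos := integral_toReal_weight_pos h hu
  have hscale : excess P D R X Z v = Real.exp (a * (v - u)) * (excess P D R X Z u -
      (v - u) * ∫ ω, (weight D R (X ω + Z ω - u)).toReal ∂P) := by
    rw [excess, excess, ← integral_const_mul, ← integral_sub (integrable_excess h hu)
      ((integrable_toReal_weight h hu).const_mul _), ← integral_const_mul]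
    refine integral_congr_ae ?_
    filter_upwards [ae_mem h hu, ae_mem h hv] with ω h1 h2
    rw [toReal_weight h1, toReal_weight h2, hab _ h1, hab _ h2]
    have : Real.exp (-(a * (X ω + Z ω - v) + b)) =
        Real.exp (a * (v - u)) * Real.exp (-(a * (X ω + Z ω - u) + b)) := by
      rw [← Real.exp_add]
      ring_nf
    rw [this]
    ring
  rw [hscale]
  refine mul_neg_of_pos_of_neg (Real.exp_pos _) ?_
  linarith [mul_pos (sub_pos.2 huv) hpos]

/-- Increments of a concave `R` shrink to the right, so the ratio of the weights at prices `v` and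
`u` is nonincreasing in the aggregate position: a higher price favours low positions. -/
theorem exp_cross_le (h : IsProfile D R) {y y' : ℝ} (huv : u < v) (hyy : y' ≤ y)
    (hy' : y' - v ∈ D) :
    Real.exp (-R (y - v)) * Real.exp (-R (y' - u)) ≤
      Real.exp (-R (y' - v)) * Real.exp (-R (y - u)) := by
  rw [← Real.exp_add, ← Real.exp_add]
  refine Real.exp_le_exp.2 ?_
  have h1 := ConcaveOn.add_le_add_of_nonneg h.conc (sub_nonneg.2 hyy) (sub_pos.2 huv) hy'
    (h.mem_of_le hy' (by linarith))
  have e1 : y' - v + (y - y') + (v - u) = y - u := by ring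
  have e2 : y' - v + (y - y') = y - v := by ring
  have e3 : y' - v + (v - u) = y' - u := by ring
  rw [e1, e2, e3] at h1
  linarith

theorem Comonotonic.singleCrossing (h : IsProfile D R)
    (hc : Comonotonic P Z fun ω => X ω + Z ω) : SingleCrossing P D R X Z := by
  intro u v huv hv hu0
  have hu := margin_sub_mem_of_le h hv huv.le
  set a : Ω → ℝ := fun ω => (weight D R (X ω + Z ω - u)).toReal with ha
  set b : Ω → ℝ := fun ω => (weight D R (X ω + Z ω - v)).toReal with hb
  have ia : Integrable a P := integrable_toReal_weight h hu
  have ib : Integrable b P := integrable_toReal_weight h hv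
  have iza : Integrable (fun ω => Z ω * a ω) P := integrable_mul_toReal_weight h Z hu
  have izb : Integrable (fun ω => Z ω * b ω) P := integrable_mul_toReal_weight h Z hv
  have pa : 0 < ∫ ω, a ω ∂P := integral_toReal_weight_pos h hu
  have pb : 0 < ∫ ω, b ω ∂P := integral_toReal_weight_pos h hv
  -- Chebyshev's argument with two independent copies, expanded so that every term integrates to a
  -- product. The total is `2 (E[Z b] E[a] - E[Z a] E[b])`, whence `H_Z(v) ≤ H_Z(u) ≤ u < v`.
  have hpair : ∀ᵐ p ∂P.prod P, Z p.1 * b p.1 * a p.2 - Z p.1 * a p.1 * b p.2 -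
      b p.1 * (Z p.2 * a p.2) + a p.1 * (Z p.2 * b p.2) ≤ 0 := by
    have h1 := Measure.quasiMeasurePreserving_fst (μ := P) (ν := P) |>.ae (ae_mem h hv)
    have h2 := Measure.quasiMeasurePreserving_snd (μ := P) (ν := P) |>.ae (ae_mem h hv)
    filter_upwards [h1, h2, hc] with p h1 h2 h3
    have h1' := h.mem_of_le h1 (by linarith : _ ≤ X p.1 + Z p.1 - u)
    have h2' := h.mem_of_le h2 (by linarith : _ ≤ X p.2 + Z p.2 - u)
    have key : (Z p.1 - Z p.2) * (b p.1 * a p.2 - b p.2 * a p.1) ≤ 0 := by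
      simp only [ha, hb, toReal_weight h1, toReal_weight h2, toReal_weight h1', toReal_weight h2']
      rcases lt_trichotomy (Z p.1) (Z p.2) with hlt | heq | hlt
      · have hle : X p.1 + Z p.1 ≤ X p.2 + Z p.2 := by
          by_contra! hgt
          exact (mul_neg_of_neg_of_pos (sub_neg.2 hlt) (sub_pos.2 hgt)).not_ge h3
        exact mul_nonpos_of_nonpos_of_nonneg (by linarith)
          (sub_nonneg.2 (exp_cross_le h huv hle h1))
      · simp [heq]
      · have hle : X p.2 + Z p.2 ≤ X p.1 + Z p.1 := by
          by_contra! hgt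
          exact (mul_neg_of_pos_of_neg (sub_pos.2 hlt) (sub_neg.2 hgt)).not_ge h3
        exact mul_nonpos_of_nonneg_of_nonpos (by linarith)
          (sub_nonpos.2 (exp_cross_le h huv hle h2))
    linarith
  have hint := integral_nonpos_of_ae hpair
  have i1 : Integrable (fun p : Ω × Ω => Z p.1 * b p.1 * a p.2 - Z p.1 * a p.1 * b p.2)
      (P.prod P) := (izb.mul_prod ia).sub (iza.mul_prod ib)
  have i2 : Integrable (fun p : Ω × Ω => Z p.1 * b p.1 * a p.2 - Z p.1 * a p.1 * b p.2 -
      b p.1 * (Z p.2 * a p.2)) (P.prod P) := i1.sub (ib.mul_prod iza)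
  rw [integral_add i2 (ia.mul_prod izb), integral_sub i1 (ib.mul_prod iza),
    integral_sub (izb.mul_prod ia) (iza.mul_prod ib),
    integral_prod_mul (fun ω => Z ω * b ω) a, integral_prod_mul (fun ω => Z ω * a ω) b,
    integral_prod_mul b (fun ω => Z ω * a ω), integral_prod_mul a (fun ω => Z ω * b ω)] at hint
  rw [excess_eq_sub h hu, sub_nonpos] at hu0
  rw [excess_eq_sub h hv, sub_neg]
  have h1 : (∫ ω, a ω ∂P) * ∫ ω, Z ω * b ω ∂P ≤ (∫ ω, a ω ∂P) * (u * ∫ ω, b ω ∂P) := by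
    have := mul_le_mul_of_nonneg_right hu0 pb.le
    linarith
  have h2 := le_of_mul_le_mul_left h1 pa
  exact h2.trans_lt (mul_lt_mul_of_pos_right huv pb)

/-! ### Monotonicity, concavity and weak* semicontinuity -/

theorem lt_Vbar_iff_of_asNondecreasing (h : IsProfile D R) (hX : essInf X P ∈ D)
    (hn : AsNondecreasing P R X) :
    v < Vbar P D R X Z ↔ margin P X Z - v ∈ D ∧ 0 < excess P D R X Z v := by
  rw [lt_Vbar_iff h hX]
  refine and_congr_right fun hm => ⟨fun hp => hp v le_rfl, fun hp u hu => hp.trans_le ?_⟩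
  exact excess_mono h hn hm (margin_sub_mem_of_le h hm hu)
    (Eventually.of_forall fun ω => by linarith)

theorem Vbar_mono (h : IsProfile D R) (hX : essInf X P ∈ D) (hn : AsNondecreasing P R X)
    {Z₁ Z₂ : Lp ℝ ∞ P} (hle : ∀ᵐ ω ∂P, Z₂ ω ≤ Z₁ ω) :
    Vbar P D R X Z₂ ≤ Vbar P D R X Z₁ := by
  have hmargin : margin P X Z₂ ≤ margin P X Z₁ := by
    rw [le_margin_iff]
    filter_upwards [hle, ae_margin_le X Z₂] with ω h1 h2
    linarith
  refine le_of_forall_lt fun v hv => ?_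
  rw [lt_Vbar_iff_of_asNondecreasing h hX hn] at hv ⊢
  have hm := h.mem_of_le hv.1 (sub_le_sub_right hmargin v)
  exact ⟨hm, hv.2.trans_le (excess_mono h hn hv.1 hm (hle.mono fun ω hω => by linarith))⟩

/-- Monotonicity and cash translativity applied to `Y ≤ Z + ‖Y - Z‖`. -/
theorem lipschitzWith_Vbar (h : IsProfile D R) (hX : essInf X P ∈ D)
    (hn : AsNondecreasing P R X) : LipschitzWith 1 (Vbar P D R X) := by
  refine LipschitzWith.of_le_add fun Y Z => ?_
  rw [dist_eq_norm, ← Vbar_add_const h hX]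
  refine Vbar_mono h hX hn ?_
  filter_upwards [ae_add_const Z ‖Y - Z‖, ae_abs_sub_le_norm Y Z] with ω h1 h2
  linarith [(abs_le.1 h2).2]

theorem concaveOn_Vbar (h : IsProfile D R) (hX : essInf X P ∈ D) (hc : AsConcave P R X) :
    ConcaveOn ℝ univ (Vbar P D R X) := by
  refine ⟨convex_univ, fun Z₁ _ Z₂ _ a b ha hb hab => ?_⟩
  refine le_of_forall_pos_lt_add fun ε hε => ?_
  -- The sign characterization is strict, so it is applied slightly below each value.
  have hlt : ∀ Z : Lp ℝ ∞ P, Vbar P D R X Z - ε < Vbar P D R X Z := fun Z => by linarith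
  obtain ⟨m1, p1⟩ := (lt_Vbar_iff_of_asNondecreasing h hX hc.asNondecreasing).1 (hlt Z₁)
  obtain ⟨m2, p2⟩ := (lt_Vbar_iff_of_asNondecreasing h hX hc.asNondecreasing).1 (hlt Z₂)
  set u₁ := Vbar P D R X Z₁ - ε with hu₁
  set u₂ := Vbar P D R X Z₂ - ε with hu₂
  have hcoe : ∀ᵐ ω ∂P, (a • Z₁ + b • Z₂ : Lp ℝ ∞ P) ω = a * Z₁ ω + b * Z₂ ω := by
    filter_upwards [Lp.coeFn_add (a • Z₁) (b • Z₂), Lp.coeFn_smul a Z₁, Lp.coeFn_smul b Z₂]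
      with ω h1 h2 h3
    rw [h1, Pi.add_apply, h2, h3]
    rfl
  have hmargin : a * margin P X Z₁ + b * margin P X Z₂ ≤ margin P X (a • Z₁ + b • Z₂) := by
    rw [le_margin_iff]
    filter_upwards [hcoe, ae_margin_le X Z₁, ae_margin_le X Z₂] with ω h1 h2 h3
    have h4 := add_le_add (mul_le_mul_of_nonneg_left h2 ha) (mul_le_mul_of_nonneg_left h3 hb)
    rw [h1]
    linear_combination h4 + X ω * hab
  have hm : margin P X (a • Z₁ + b • Z₂) - (a * u₁ + b * u₂) ∈ D := by
    refine h.mem_of_le (h.convex m1 m2 ha hb hab) ?_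
    simp only [smul_eq_mul]
    linarith
  have hlt' : a * u₁ + b * u₂ < Vbar P D R X (a • Z₁ + b • Z₂) := by
    refine (lt_Vbar_iff_of_asNondecreasing h hX hc.asNondecreasing).2 ⟨hm, ?_⟩
    have hpos : 0 < a * excess P D R X Z₁ u₁ + b * excess P D R X Z₂ u₂ := by
      rcases ha.eq_or_lt with rfl | ha'
      · obtain rfl : b = 1 := by linarith
        simpa using p2
      · exact add_pos_of_pos_of_nonneg (mul_pos ha' p1) (mul_nonneg hb p2.le)
    refine hpos.trans_le ?_
    rw [excess_eq_gain h m1, excess_eq_gain h m2, excess_eq_gain h hm, ← integral_const_mul,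
      ← integral_const_mul, ← integral_add ((integrable_gain h m1).const_mul a)
        ((integrable_gain h m2).const_mul b)]
    refine integral_mono_ae (((integrable_gain h m1).const_mul a).add
      ((integrable_gain h m2).const_mul b)) (integrable_gain h hm) ?_
    filter_upwards [hcoe, hc, ae_add_sub_mem h m1, ae_add_sub_mem h m2] with ω h1 h2 h3 h4
    have h5 := (concaveOn_gain h h2).2 h3 h4 ha hb hab
    have h6 : (a • Z₁ + b • Z₂ : Lp ℝ ∞ P) ω - (a * u₁ + b * u₂) =
        a • (Z₁ ω - u₁) + b • (Z₂ ω - u₂) := by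
      rw [h1]
      simp only [smul_eq_mul]
      ring
    rw [h6]
    exact h5
  simp only [smul_eq_mul]
  have : a * u₁ + b * u₂ = a * Vbar P D R X Z₁ + b * Vbar P D R X Z₂ - ε := by
    rw [hu₁, hu₂]
    linear_combination (-ε) * hab
  linarith

omit [IsProbabilityMeasure P] in
theorem tendsto_weakStar {f : Ω → ℝ} (hf : Integrable f P) (Z : Lp ℝ ∞ P) :
    Tendsto (fun Y : Lp ℝ ∞ P => ∫ ω, f ω * Y ω ∂P) (@nhds _ (weakStarTopology P) Z)
      (𝓝 (∫ ω, f ω * Z ω ∂P)) := by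
  have hcont : Continuous[weakStarTopology P, inferInstance]
      fun Y : Lp ℝ ∞ P => ∫ ω, hf.toL1 f ω * Y ω ∂P :=
    continuous_iInf_dom (i := hf.toL1 f) continuous_induced_dom
  have heq : (fun Y : Lp ℝ ∞ P => ∫ ω, hf.toL1 f ω * Y ω ∂P) =
      fun Y : Lp ℝ ∞ P => ∫ ω, f ω * Y ω ∂P := by
    funext Y
    refine integral_congr_ae ?_
    filter_upwards [hf.coeFn_toL1] with ω hω
    rw [hω]
  rw [heq] at hcont
  exact @Continuous.tendsto _ _ (weakStarTopology P) _ _ hcont Z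

omit [IsProbabilityMeasure P] in
theorem integrable_mul_coe {f : Ω → ℝ} (hf : Integrable f P) (Y : Lp ℝ ∞ P) :
    Integrable (fun ω => f ω * Y ω) P :=
  hf.mul_bdd (Lp.aestronglyMeasurable Y) (ae_abs_le_norm Y)

/-- Testing against the indicator of `{𝒳 + Z < d}`, which has positive probability: a margin of at
least `c` would force an average of at least `c` there, but the average for `Z` is at most `d < c`.
-/
theorem eventually_weakStar_margin_lt {c : ℝ} (hc : margin P X Z < c) :
    ∀ᶠ Y in @nhds _ (weakStarTopology P) Z, margin P X Y < c := by
  obtain ⟨d, hd, hdc⟩ := exists_between hc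
  set A : Set Ω := {ω | X ω + Z ω < d} with hA
  have hAm : MeasurableSet A := measurableSet_lt
    ((Lp.stronglyMeasurable X).measurable.add (Lp.stronglyMeasurable Z).measurable)
    measurable_const
  have hApos : 0 < P.real A := by
    refine measureReal_nonneg.lt_of_ne' fun h0 => hd.not_ge (le_margin_iff.2 ?_)
    filter_upwards [measure_eq_zero_iff_ae_notMem.1 ((measureReal_eq_zero_iff).1 h0)] with ω hω
    exact not_lt.1 hω
  set f : Ω → ℝ := A.indicator 1 with hf_def
  have hf : Integrable f P := (integrable_const (1 : ℝ)).indicator hAm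
  have hf0 : ∀ ω, 0 ≤ f ω := fun ω => indicator_nonneg (fun _ _ => zero_le_one) ω
  have hfi : ∫ ω, f ω ∂P = P.real A := integral_indicator_one hAm
  have hZ : ∫ ω, f ω * X ω ∂P + ∫ ω, f ω * Z ω ∂P ≤ d * P.real A := by
    rw [← integral_add (integrable_mul_coe hf X) (integrable_mul_coe hf Z), ← hfi,
      ← integral_const_mul]
    refine integral_mono ((integrable_mul_coe hf X).add (integrable_mul_coe hf Z))
      (hf.const_mul d) fun ω => ?_
    by_cases hω : ω ∈ A
    · simpa [hf_def, hω] using (show X ω + Z ω < d from hω).le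
    · simp [hf_def, hω]
  have hlt : ∫ ω, f ω * Z ω ∂P < c * P.real A - ∫ ω, f ω * X ω ∂P := by
    have := mul_lt_mul_of_pos_right hdc hApos
    linarith
  filter_upwards [(tendsto_weakStar hf Z).eventually (gt_mem_nhds hlt)] with Y hY
  by_contra! hcY
  have hY' : c * P.real A ≤ ∫ ω, f ω * X ω ∂P + ∫ ω, f ω * Y ω ∂P := by
    rw [← integral_add (integrable_mul_coe hf X) (integrable_mul_coe hf Y), ← hfi,
      ← integral_const_mul]
    refine integral_mono_ae (hf.const_mul c)
      ((integrable_mul_coe hf X).add (integrable_mul_coe hf Y)) ?_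
    filter_upwards [le_margin_iff.1 hcY] with ω hω
    have := mul_le_mul_of_nonneg_left hω (hf0 ω)
    linarith
  linarith

/-- By concavity the gain at `Y - u` lies below its tangent at `Z - u`. The slope `ξ` is integrable,
so this affine majorant is weak* continuous in `Y`. -/
theorem eventually_weakStar_excess_neg (h : IsProfile D R) (hc : AsConcave P R X)
    (hu : margin P X Z - u ∈ D) (hneg : excess P D R X Z u < 0) :
    ∀ᶠ Y in @nhds _ (weakStarTopology P) Z,
      margin P X Y - u ∈ D → excess P D R X Y u < 0 := by
  set ξ : Ω → ℝ := fun ω => Real.exp (-R (X ω + (Z ω - u))) *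
    (1 - (Z ω - u) * deriv R (X ω + (Z ω - u))) with hξ_def
  have hξ : Integrable ξ P := by
    have hmeas : AEStronglyMeasurable
        (fun ω => 1 - (Z ω - u) * deriv R (X ω + (Z ω - u))) P := by
      have hX := (Lp.stronglyMeasurable X).measurable
      have hZ := (Lp.stronglyMeasurable Z).measurable
      exact (measurable_const.sub ((hZ.sub_const u).mul
        ((measurable_deriv R).comp (hX.add (hZ.sub_const u))))).aestronglyMeasurable
    have hint : Integrable (fun ω => Real.exp (-R (X ω + (Z ω - u)))) P := by
      refine (integrable_toReal_weight h hu).congr ?_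
      filter_upwards [ae_mem h hu] with ω hω
      rw [toReal_weight hω, add_sub_assoc]
    -- The derivative of `R` is nonnegative and nonincreasing, so its value at the lower end of the
    -- position bounds it.
    refine hint.mul_bdd (c := 1 + (‖Z‖ + |u|) * deriv R (margin P X Z - u)) hmeas ?_
    filter_upwards [ae_margin_le X Z, ae_abs_le_norm Z] with ω h1 h2
    have h3 : margin P X Z - u ≤ X ω + (Z ω - u) := by linarith
    have h4 := h.deriv_nonneg (h.mem_of_le hu h3)
    rw [Real.norm_eq_abs]
    refine (abs_sub _ _).trans ?_
    rw [abs_one, abs_mul, abs_of_nonneg h4]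
    refine add_le_add_right (mul_le_mul ((abs_sub _ _).trans (add_le_add_left h2 _))
      (h.deriv_le_deriv hu h3) h4 (by positivity)) _
  have hlt : ∫ ω, ξ ω * Z ω ∂P < ∫ ω, ξ ω * Z ω ∂P - excess P D R X Z u := by linarith
  filter_upwards [(tendsto_weakStar hξ Z).eventually (gt_mem_nhds hlt)] with Y hY hm
  have key : excess P D R X Y u ≤
      excess P D R X Z u + (∫ ω, ξ ω * Y ω ∂P - ∫ ω, ξ ω * Z ω ∂P) := by
    have i1 := integrable_mul_coe hξ Y
    have i2 := integrable_mul_coe hξ Z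
    have i3 : Integrable (fun ω => ξ ω * Y ω - ξ ω * Z ω) P := i1.sub i2
    rw [excess_eq_gain h hm, excess_eq_gain h hu, ← integral_sub i1 i2,
      ← integral_add (integrable_gain h hu) i3]
    refine integral_mono_ae (integrable_gain h hm) ((integrable_gain h hu).add i3) ?_
    filter_upwards [hc, ae_add_sub_mem h hu, ae_add_sub_mem h hm] with ω h1 h2 h3
    have h4 := ConcaveOn.le_add_mul_sub (concaveOn_gain h h1) h2 h3 (hasDerivAt_gain h h2)
    refine h4.trans (le_of_eq ?_)
    simp only [hξ_def]
    ring
  linarith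

theorem weakStar_upperSemicontinuous_Vbar (h : IsProfile D R) (hX : essInf X P ∈ D)
    (hc : AsConcave P R X) :
    @UpperSemicontinuous (Lp ℝ ∞ P) ℝ (weakStarTopology P) _ (Vbar P D R X) :=
  fun Z _ hlt => eventually_Vbar_lt h hX (hc.asNondecreasing.singleCrossing h Z)
    (fun _ hm => eventually_weakStar_margin_lt hm)
    (fun _ hu hneg => eventually_weakStar_excess_neg h hc hu hneg) hlt

end Conditions

end EqPricing

end

theorem lemma3p6 {Ω : Type*} [MeasurableSpace Ω] (P : Measure Ω) [IsProbabilityMeasure P]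
    (D : Set ℝ) (hD : D = Set.univ ∨ D = Set.Ioi 0)
    (R : ℝ → ℝ) (hR_mono : StrictMonoOn R D) (hR_diff : DifferentiableOn ℝ R D)
    (hR_conc : ConcaveOn ℝ D R)
    (X : Lp ℝ ∞ P) (hX : essInf X P ∈ D) :
    -- the minimum in the definition of the extension is attained
    (∀ Z : Lp ℝ ∞ P, (EqPricing.V P D R X Z).Nonempty →
      IsLeast (EqPricing.V P D R X Z) (EqPricing.Vbar P D R X Z)) ∧
    -- bounds
    (∀ Z : Lp ℝ ∞ P, EqPricing.Vbar P D R X Z ∈ Set.Icc (essInf Z P) (essSup Z P)) ∧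
    -- law invariance
    (∀ Z₁ Z₂ : Lp ℝ ∞ P,
      IdentDistrib (fun ω => (Z₁ ω, X ω + Z₁ ω)) (fun ω => (Z₂ ω, X ω + Z₂ ω)) P P →
        EqPricing.Vbar P D R X Z₁ = EqPricing.Vbar P D R X Z₂) ∧
    -- cash translativity
    (∀ (Z : Lp ℝ ∞ P) (z : ℝ),
      EqPricing.Vbar P D R X (Z + Lp.const ∞ P z) = EqPricing.Vbar P D R X Z + z) ∧
    -- strong lower semicontinuity, and strong continuity under each uniqueness condition
    LowerSemicontinuous (EqPricing.Vbar P D R X) ∧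
    (∀ Z : Lp ℝ ∞ P, EqPricing.Comonotonic P Z (fun ω => X ω + Z ω) →
      ContinuousAt (EqPricing.Vbar P D R X) Z) ∧
    (EqPricing.IsLinearOn D R ∨ EqPricing.AsNondecreasing P R X ∨ EqPricing.AsConcave P R X →
      Continuous (EqPricing.Vbar P D R X)) ∧
    -- monotonicity and Lipschitz continuity
    (EqPricing.AsNondecreasing P R X →
      (∀ Z₁ Z₂ : Lp ℝ ∞ P, (∀ᵐ ω ∂P, Z₂ ω ≤ Z₁ ω) →
        EqPricing.Vbar P D R X Z₂ ≤ EqPricing.Vbar P D R X Z₁) ∧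
      LipschitzWith 1 (EqPricing.Vbar P D R X)) ∧
    -- concavity and weak* upper semicontinuity
    (EqPricing.AsConcave P R X →
      ConcaveOn ℝ Set.univ (EqPricing.Vbar P D R X) ∧
      @UpperSemicontinuous (Lp ℝ ∞ P) ℝ (EqPricing.weakStarTopology P) _
        (EqPricing.Vbar P D R X)) := by
  have h : EqPricing.IsProfile D R := ⟨hD, hR_mono, hR_diff, hR_conc⟩
  refine ⟨fun Z => EqPricing.isLeast_Vbar h hX, EqPricing.Vbar_mem_Icc h hX,
    fun _ _ => EqPricing.Vbar_congr_law h hX, EqPricing.Vbar_add_const h hX,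
    EqPricing.lowerSemicontinuous_Vbar h hX,
    fun Z hc => EqPricing.continuousAt_Vbar h hX (EqPricing.Comonotonic.singleCrossing h hc),
    fun hor => continuous_iff_continuousAt.2 fun Z => EqPricing.continuousAt_Vbar h hX ?_,
    fun hn => ⟨fun _ _ hle => EqPricing.Vbar_mono h hX hn hle,
      EqPricing.lipschitzWith_Vbar h hX hn⟩,
    fun hc => ⟨EqPricing.concaveOn_Vbar h hX hc,
      EqPricing.weakStar_upperSemicontinuous_Vbar h hX hc⟩⟩
  rcases hor with hl | hn | hc
  · exact EqPricing.IsLinearOn.singleCrossing h hl Z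
  · exact EqPricing.AsNondecreasing.singleCrossing h hn Z
  · exact EqPricing.AsNondecreasing.singleCrossing h hc.asNondecreasing Z
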